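/- Let $V$ be a set and let $K$ be a (not necessarily finite or locally finite) abstract simplicial complex with vertices in $V$, i.e. a family of nonempty finite subsets of $V$, called faces, that contains every nonempty subset of each of its members. Let $|K|$ be its polyhedron: the set of all functions $x\colon V\to[0,\infty)$ that vanish outside some face of $K$ and satisfy $\sum_{v\in V}x(v)=1$, equipped with the metric topology, i.e. the topology of the metric $d(x,y)=\bigl(\sum_{v\in V}(x(v)-y(v))^2\bigr)^{1/2}$. Call a continuous map $g\colon X\to M$ from a compact metrizable space $X$ to a metrizable space $M$ a *Krasinkiewicz map* if every continuum (nonempty compact connected subset) $L\subset X$ is either contained in a fiber $g^{-1}(y)$, $y\in M$, or contains a connected component of a fiber of $g$. Call a metrizable space $M$ a *Krasinkiewicz space* if, for every compact metrizable space $X$, the Krasinkiewicz maps form a dense subset of the space $C(X,M)$ of continuous maps $X\to M$ with the topology of uniform convergence (with respect to any metric compatible with the topology of $M$; for compact $X$ the topology does not depend on this metric). Then the polyhedron $|K|$ of every such simplicial complex $K$ is a Krasinkiewicz space. -/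

import Mathlib

open scoped ENNReal

universe w u

/-- The set of points of the simplicial complex `K`, in barycentric coordinates: families
`x : V → ℝ` of nonnegative numbers which vanish off some face of `K` and add up to `1`.
They are taken inside `ℓ²(V)`, so that the distance between two points is
`(∑ v, (x v - y v) ^ 2) ^ (1 / 2)`. Elements of `V` need not all be vertices of `K`. -/
def PreAbstractSimplicialComplex.realization {V : Type*} (K : PreAbstractSimplicialComplex V) :
    Set (lp (fun _ : V => ℝ) 2) :=
  {x | (∀ v, 0 ≤ x v) ∧ ∃ s ∈ K.faces, (∀ v, v ∉ s → x v = 0) ∧ ∑ v ∈ s, x v = 1}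

/-- The polyhedron of the simplicial complex `K`: its underlying space with the metric topology,
that is, the topology of the `ℓ²`-distance of barycentric coordinates. -/
abbrev PreAbstractSimplicialComplex.Polyhedron {V : Type*} (K : PreAbstractSimplicialComplex V) :
    Type _ :=
  ↥K.realization

/-- A map `g` is a Krasinkiewicz map if every continuum `L` (nonempty compact connected set) in its
domain is contained in a fiber of `g` or contains a component of a fiber of `g`. -/
def IsKrasinkiewiczMap {X M : Type*} [TopologicalSpace X] [TopologicalSpace M] (g : C(X, M)) :
    Prop :=
  ∀ L : Set X, IsCompact L → IsConnected L →
    (∃ y : M, L ⊆ g ⁻¹' {y}) ∨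
      ∃ (y : M) (x : X), x ∈ g ⁻¹' {y} ∧ connectedComponentIn (g ⁻¹' {y}) x ⊆ L

/-- A metrizable space `M` is a Krasinkiewicz space if for every compactum (compact metrizable
space) `X` the Krasinkiewicz maps are dense in `C(X, M)`. As `X` is compact, Mathlib's topology on
`C(X, M)` is the topology of uniform convergence with respect to any compatible metric on `M`. -/
def IsKrasinkiewiczSpace (M : Type u) [TopologicalSpace M]
    [TopologicalSpace.MetrizableSpace M] : Prop :=
  ∀ (X : Type w) [TopologicalSpace X] [CompactSpace X] [TopologicalSpace.MetrizableSpace X],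
    Dense {g : C(X, M) | IsKrasinkiewiczMap g}

/-!
A generic real function `h` on a compactum has the following property: if `h` maps a continuum `L`
onto a set containing `[a, b]`, then `L` contains a component of a fiber of `h` over `[a, b]`. To
see this, fold the graph of a function at levels just above `t`, everywhere except near a closed
set `A`. A continuum disjoint from a neighborhood of `A` that crosses the fold contains a smaller
one, on which the original function stays above `t`, and the level `t` separates the components of
fibers through the latter from `A`. Such refinements are stable under small perturbations, so by
Baire category a generic `h` admits them for countably many sets `A`, enough to detect every point
outside `L`; nesting the refinements gives a component of a fiber that does not leave `L`.

A map into a polyhedron is first moved into finitely many coordinates. Divided by their maximum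
rather than by their sum, the barycentric coordinates take values in `[0, 1]`, one of them is `1`,
and they can be perturbed independently as long as the values `0` and `1` are preserved. Points
normalized in this way are determined by their barycentric coordinates, hence a component of a
fiber of the perturbed map is contained in a component of a fiber of each perturbed coordinate.
-/

open Set Filter Topology

section FiberComponents

variable {X : Type*} [TopologicalSpace X]

theorem exists_isClopen_disjoint_of_connectedComponent [CompactSpace X] [T2Space X] {x : X}
    {Z : Set X} (hZ : IsClosed Z) (hxZ : Disjoint (connectedComponent x) Z) :
    ∃ D, IsClopen D ∧ x ∈ D ∧ Disjoint D Z := by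
  have : Nonempty {s : Set X // IsClopen s ∧ x ∈ s} := ⟨univ, isClopen_univ, mem_univ x⟩
  have hdir : Directed (· ⊇ ·) fun s : {s : Set X // IsClopen s ∧ x ∈ s} => (s : Set X) :=
    fun s t => ⟨⟨s ∩ t, s.2.1.inter t.2.1, s.2.2, t.2.2⟩, inter_subset_left, inter_subset_right⟩
  rw [connectedComponent_eq_iInter_isClopen, disjoint_left] at hxZ
  obtain ⟨⟨D, hD, hxD⟩, hDZ⟩ := exists_subset_nhds_of_compactSpace hdir (fun s => s.2.1.isClosed)
    fun y hy => hZ.isOpen_compl.mem_nhds (hxZ hy)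
  exact ⟨D, hD, hxD, disjoint_left.mpr hDZ⟩

/-- Boundary bumping. -/
theorem exists_mem_connectedComponentIn_eq [T2Space X] {L : Set X} (hLc : IsCompact L)
    (hL : IsPreconnected L) {f : X → ℝ} (hf : Continuous f) {t : ℝ} {x y : X} (hx : x ∈ L)
    (hxt : t ≤ f x) (hy : y ∈ L) (hyt : f y < t) :
    ∃ z ∈ connectedComponentIn (L ∩ {z | t ≤ f z}) x, f z = t := by
  set F : Set X := L ∩ {z | t ≤ f z}
  have hF : IsCompact F := hLc.inter_right (isClosed_le continuous_const hf)
  have hxF : x ∈ F := ⟨hx, hxt⟩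
  have : CompactSpace F := isCompact_iff_compactSpace.mp hF
  by_contra! hne
  rw [connectedComponentIn_eq_image hxF, forall_mem_image] at hne
  obtain ⟨D, hD, hxD, hDt⟩ := exists_isClopen_disjoint_of_connectedComponent
    (isClosed_eq (hf.comp continuous_subtype_val) continuous_const) (disjoint_left.mpr hne)
  have himage : ∀ {E : Set F}, IsClosed E → IsClosed (Subtype.val '' E) := fun hE =>
    hF.isClosed.isClosedMap_subtype_val _ hE
  -- A clopen part of `F` that misses the level `t` is clopen in `L`.
  obtain ⟨_, -, ⟨p, hpD, rfl⟩, ⟨q, hqD, hqp⟩ | hpt⟩ := isPreconnected_closed_iff.mp hL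
    (Subtype.val '' D) (Subtype.val '' Dᶜ ∪ {z | f z ≤ t}) (himage hD.isClosed)
    ((himage hD.compl.isClosed).union (isClosed_le hf continuous_const))
    (fun z hz => by
      rcases le_total (f z) t with hzt | hzt
      · exact Or.inr (Or.inr hzt)
      · rcases em (⟨z, hz, hzt⟩ ∈ D) with hzD | hzD
        · exact Or.inl ⟨_, hzD, rfl⟩
        · exact Or.inr (Or.inl ⟨_, hzD, rfl⟩))
    ⟨x, hx, _, hxD, rfl⟩ ⟨y, hy, Or.inr hyt.le⟩
  · exact hqD (Subtype.val_injective hqp ▸ hpD)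
  · exact disjoint_left.mp hDt hpD (le_antisymm hpt p.2.2)

theorem isCompact_connectedComponentIn {F : Set X} (hF : IsCompact F) {x : X}
    (hx : x ∈ F) : IsCompact (connectedComponentIn F x) := by
  have : CompactSpace F := isCompact_iff_compactSpace.mp hF
  rw [connectedComponentIn_eq_image hx]
  exact isClosed_connectedComponent.isCompact.image continuous_subtype_val

/-- The component of `p` in the fiber of `g` through `p`. -/
def fiberComponent {M : Type*} (g : X → M) (p : X) : Set X :=
  connectedComponentIn (g ⁻¹' {g p}) p

theorem mem_fiberComponent {M : Type*} (g : X → M) (p : X) : p ∈ fiberComponent g p :=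
  mem_connectedComponentIn rfl

theorem isPreconnected_fiberComponent {M : Type*} (g : X → M) (p : X) :
    IsPreconnected (fiberComponent g p) :=
  isPreconnected_connectedComponentIn

theorem eq_of_mem_fiberComponent {M : Type*} {g : X → M} {p q : X}
    (hq : q ∈ fiberComponent g p) : g q = g p :=
  connectedComponentIn_subset (g ⁻¹' {g p}) p hq

theorem fiberComponent_subset_fiberComponent {M N : Type*} {g : X → M} {h : X → N} {p : X}
    (hgh : ∀ q, g q = g p → h q = h p) : fiberComponent g p ⊆ fiberComponent h p :=
  connectedComponentIn_mono p hgh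

/-- The set `L` is a continuum, and `h` maps it onto a set that contains the nondegenerate
interval `[a, b]`. -/
structure IsCrossing (h : X → ℝ) (L : Set X) (a b : ℝ) : Prop where
  isCompact : IsCompact L
  isConnected : IsConnected L
  lt : a < b
  surjOn : SurjOn h L (Icc a b)

theorem isCrossing_of_le_of_le {h : X → ℝ} (hh : Continuous h) {L : Set X} (hLc : IsCompact L)
    (hL : IsConnected L) {a b : ℝ} (hab : a < b) {x y : X} (hx : x ∈ L) (hxa : h x ≤ a)
    (hy : y ∈ L) (hyb : b ≤ h y) : IsCrossing h L a b :=
  ⟨hLc, hL, hab, (Icc_subset_Icc hxa hyb).trans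
    (hL.isPreconnected.intermediate_value hx hy hh.continuousOn)⟩

theorem IsCrossing.mono {h : X → ℝ} {L : Set X} {a b c d : ℝ} (hL : IsCrossing h L a b)
    (hac : a ≤ c) (hcd : c < d) (hdb : d ≤ b) : IsCrossing h L c d :=
  ⟨hL.isCompact, hL.isConnected, hcd, (Icc_subset_Icc hac hdb).trans hL.surjOn⟩

/-- Inside `L` and over a subinterval `[c, d]` of `[a, b]` there is a crossing such that the
components of fibers of `h` through its points over `[c, d]` miss `A`. Such crossings are nested
in order to find a single component of a fiber that misses countably many sets `A`. -/
def HasCrossingAvoiding (h : X → ℝ) (A L : Set X) (a b : ℝ) : Prop :=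
  ∃ L' ⊆ L, ∃ c d, Icc c d ⊆ Icc a b ∧ IsCrossing h L' c d ∧
    ∀ p ∈ L' ∩ h ⁻¹' Icc c d, Disjoint (fiberComponent h p) A

theorem IsCrossing.exists_forall_disjoint_fiberComponent [T2Space X] {h : X → ℝ}
    (hh : Continuous h) {L : Set X} {a b : ℝ} (hL : IsCrossing h L a b) {𝒜 : Set (Set X)}
    (h𝒜 : 𝒜.Countable)
    (H : ∀ A ∈ 𝒜, ∀ M ⊆ L, ∀ c d, IsCrossing h M c d → HasCrossingAvoiding h A M c d) :
    ∃ p ∈ L, h p ∈ Icc a b ∧ ∀ A ∈ 𝒜, Disjoint (fiberComponent h p) A := by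
  obtain ⟨A, hA⟩ := (h𝒜.insert ∅).exists_eq_range (insert_nonempty ∅ 𝒜)
  let S := {T : Set X × ℝ × ℝ // T.1 ⊆ L ∧ IsCrossing h T.1 T.2.1 T.2.2}
  let slab (T : S) : Set X := T.1.1 ∩ h ⁻¹' Icc T.1.2.1 T.1.2.2
  have hrefine (n : ℕ) (T : S) : ∃ T' : S, slab T' ⊆ slab T ∧
      ∀ p ∈ slab T', Disjoint (fiberComponent h p) (A n) := by
    obtain hn | hn : A n ∈ insert ∅ 𝒜 := hA ▸ mem_range_self n
    · exact ⟨T, Subset.rfl, fun p _ => hn ▸ disjoint_empty _⟩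
    · obtain ⟨L', hL', c, d, hcd, hcross, hdisj⟩ := H (A n) hn _ T.2.1 _ _ T.2.2
      exact ⟨⟨(L', c, d), hL'.trans T.2.1, hcross⟩,
        inter_subset_inter hL' (preimage_mono hcd), hdisj⟩
  choose next hnext hdisj using hrefine
  let T : ℕ → S := Nat.rec ⟨(L, a, b), Subset.rfl, hL⟩ next
  have hcompact (n : ℕ) : IsCompact (slab (T n)) :=
    (T n).2.2.isCompact.inter_right (isClosed_Icc.preimage hh)
  have hnonempty (n : ℕ) : (slab (T n)).Nonempty := by
    have hT := (T n).2.2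
    obtain ⟨x, hx, hxa⟩ := hT.surjOn (left_mem_Icc.mpr hT.lt.le)
    exact ⟨x, hx, hxa.ge, hxa.trans_le hT.lt.le⟩
  obtain ⟨p, hp⟩ := IsCompact.nonempty_iInter_of_sequence_nonempty_isCompact_isClosed
    (fun n => slab (T n)) (fun n => hnext n (T n)) hnonempty (hcompact 0)
    fun n => (hcompact n).isClosed
  rw [mem_iInter] at hp
  refine ⟨p, (hp 0).1, (hp 0).2, fun B hB => ?_⟩
  obtain ⟨n, rfl⟩ : B ∈ range A := hA ▸ mem_insert_of_mem ∅ hB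
  exact hdisj n (T n) p (hp (n + 1))

/-- The levels `c < d < t ≤ u` record a fold of `f` that sends the level `u` below `c` off `U` but
stays above `d` on the level `t` and near `A`. -/
theorem IsCrossing.hasCrossingAvoiding_of_fold [T2Space X] {f h : X → ℝ} (hf : Continuous f)
    (hh : Continuous h) {A U L : Set X} {a b c d t u : ℝ} (hL : IsCrossing h L a b)
    (hLU : Disjoint L U) (hac : a ≤ c) (hcd : c < d) (hdb : d ≤ b) (htu : t ≤ u)
    (hlow : ∀ x, h x ≤ a → f x < t) (hhigh : ∀ x, b ≤ h x → u ≤ f x)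
    (hdip : ∀ x ∉ U, f x = u → h x ≤ c) (ht : ∀ x, f x = t → d < h x)
    (hA : ∀ x ∈ A, t ≤ f x → d < h x) : HasCrossingAvoiding h A L a b := by
  obtain ⟨x, hx, hxb⟩ := hL.surjOn (right_mem_Icc.mpr hL.lt.le)
  obtain ⟨y, hy, hya⟩ := hL.surjOn (left_mem_Icc.mpr hL.lt.le)
  have hxu : u ≤ f x := hhigh x hxb.ge
  have hxt : t ≤ f x := htu.trans hxu
  obtain ⟨z, hz, hzt⟩ := exists_mem_connectedComponentIn_eq hL.isCompact
    hL.isConnected.isPreconnected hf hx hxt hy (hlow y hya.le)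
  set F := L ∩ {z | t ≤ f z}
  have hF : IsCompact F := hL.isCompact.inter_right (isClosed_le continuous_const hf)
  have hxF : x ∈ F := ⟨hx, hxt⟩
  have hCF : connectedComponentIn F x ⊆ F := connectedComponentIn_subset F x
  obtain ⟨q, hq, hqu⟩ := isPreconnected_connectedComponentIn.intermediate_value hz
    (mem_connectedComponentIn hxF) hf.continuousOn ⟨hzt.trans_le htu, hxu⟩
  have hqc : h q ≤ c := hdip q (hLU.notMem_of_mem_left (hCF hq).1) hqu
  refine ⟨connectedComponentIn F x, hCF.trans inter_subset_left, c, d, Icc_subset_Icc hac hdb,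
    isCrossing_of_le_of_le hh (isCompact_connectedComponentIn hF hxF)
      (isConnected_connectedComponentIn_iff.mpr hxF) hcd hq hqc
      (mem_connectedComponentIn hxF) (hdb.trans hxb.ge), ?_⟩
  rintro p ⟨hp, -, hpd⟩
  refine disjoint_left.mpr fun r hr hrA => ?_
  have hle : ∀ s ∈ fiberComponent h p, h s ≤ d := fun s hs =>
    (eq_of_mem_fiberComponent hs).trans_le hpd
  have hrt : f r < t := lt_of_not_ge fun hrt => (hA r hrA hrt).not_ge (hle r hr)
  obtain ⟨s, hs, hst⟩ := (isPreconnected_fiberComponent h p).intermediate_value hr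
    (mem_fiberComponent h p) hf.continuousOn ⟨hrt.le, (hCF hp).2⟩
  exact (ht s hst).not_ge (hle s hs)

theorem exists_fold [NormalSpace X] {A U : Set X} (hA : IsClosed A) (hU : IsOpen U) (hAU : A ⊆ U)
    (f : C(X, ℝ)) (t : ℝ) {θ : ℝ} (hθ : 0 ≤ θ) :
    ∃ h : C(X, ℝ), (∀ x, h x ≤ f x) ∧ (∀ x, f x - 4 * θ ≤ h x) ∧
      (∀ x, t ≤ f x → t - 3 * θ ≤ h x) ∧ (∀ x, f x = t → h x = t) ∧ (∀ x ∈ A, h x = f x) ∧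
      ∀ x ∉ U, f x = t + θ → h x = t - 3 * θ := by
  obtain ⟨s, hsA, hsU, hs⟩ := exists_continuous_zero_one_of_isClosed hA hU.isClosed_compl
    (disjoint_compl_right_iff_subset.mpr hAU)
  let tent (x : X) : ℝ := 4 * max 0 (θ - |f x - (t + θ)|)
  have htent (x : X) : 0 ≤ s x * tent x ∧ s x * tent x ≤ tent x := by
    have h0 : 0 ≤ tent x := by positivity
    exact ⟨mul_nonneg (hs x).1 h0, mul_le_of_le_one_left h0 (hs x).2⟩
  refine ⟨⟨fun x => f x - s x * tent x, by fun_prop⟩, fun x => sub_le_self _ (htent x).1,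
    fun x => ?_, fun x hx => ?_, fun x hx => ?_, fun x hx => ?_, fun x hx hxt => ?_⟩ <;>
    simp only [ContinuousMap.coe_mk]
  · have hle : tent x ≤ 4 * θ := by
      simp only [tent]; gcongr; exact max_le hθ (sub_le_self _ (abs_nonneg _))
    linarith [(htent x).2]
  · have hle : max 0 (θ - |f x - (t + θ)|) ≤ (f x - t + 3 * θ) / 4 := max_le (by linarith)
      (by linarith [neg_abs_le (f x - (t + θ)), le_abs_self (f x - (t + θ))])
    linarith [(htent x).2, show tent x = 4 * max 0 (θ - |f x - (t + θ)|) from rfl]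
  · simp [tent, hx, abs_of_nonneg hθ]
  · simp [hsA hx]
  · simp only [hsU hx, Pi.one_apply, tent, hxt, sub_self, abs_zero, sub_zero, max_eq_right hθ]
    ring

theorem eventually_residual_hasCrossingAvoiding [CompactSpace X] [T2Space X] {A U : Set X}
    (hA : IsClosed A) (hU : IsOpen U) (hAU : A ⊆ U) {a b : ℝ} (hab : a < b) :
    ∀ᶠ h : C(X, ℝ) in residual C(X, ℝ), ∀ L, Disjoint L U → IsCrossing h L a b →
      HasCrossingAvoiding h A L a b := by
  refine mem_of_superset (residual_of_dense_open isOpen_interior ?_) interior_subset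
  refine Metric.dense_iff.mpr fun f ε hε => ?_
  obtain ⟨θ, hθ, hθab, hθε⟩ : ∃ θ : ℝ, 0 < θ ∧ a + 6 * θ ≤ b ∧ 4 * θ < ε :=
    ⟨min ((b - a) / 6) (ε / 5), by have := sub_pos.mpr hab; positivity,
      by linarith [min_le_left ((b - a) / 6) (ε / 5)],
      by linarith [min_le_right ((b - a) / 6) (ε / 5)]⟩
  obtain ⟨k, hkf, hfk, hk, hkt, hkA, hkU⟩ := exists_fold hA hU hAU f (a + 4 * θ) hθ.le
  refine ⟨k, ?_, mem_interior_iff_mem_nhds.mpr (mem_of_superset (Metric.ball_mem_nhds k hθ) ?_)⟩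
  · refine ((ContinuousMap.dist_le (by positivity)).mpr fun x => ?_).trans_lt hθε
    rw [Real.dist_eq, abs_le]
    constructor <;> linarith [hkf x, hfk x]
  · intro h hhk L hLU hL
    have hclose (x : X) : k x - θ < h x ∧ h x < k x + θ := by
      have := abs_lt.mp ((ContinuousMap.dist_apply_le_dist x).trans_lt (Metric.mem_ball.mp hhk))
      constructor <;> linarith
    refine hL.hasCrossingAvoiding_of_fold (c := a + 2 * θ) (d := a + 3 * θ) (t := a + 4 * θ)
      (u := a + 5 * θ) f.continuous h.continuous hLU (by linarith) (by linarith) (by linarith)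
      (by linarith) (fun x hx => ?_) (fun x hx => ?_) (fun x hx hxu => ?_) (fun x hx => ?_)
      fun x hx hxt => ?_
    · by_contra! hxt
      linarith [hk x hxt, hclose x]
    · linarith [hkf x, hclose x]
    · linarith [hkU x hx (by linarith), hclose x]
    · linarith [hkt x hx, hclose x]
    · linarith [hkA x hx, hclose x]

/-- Over every interval that it crosses on a continuum, `h` has a component of a fiber contained
in this continuum. -/
def HasFiberComponentsInCrossings (h : X → ℝ) : Prop :=
  ∀ L a b, IsCrossing h L a b → ∃ p, h p ∈ Icc a b ∧ fiberComponent h p ⊆ L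

theorem exists_countable_separating_pairs [RegularSpace X] [SecondCountableTopology X] :
    ∃ 𝒮 : Set (Set X × Set X), 𝒮.Countable ∧
      (∀ P ∈ 𝒮, IsClosed P.1 ∧ IsOpen P.2 ∧ P.1 ⊆ P.2) ∧
      ∀ L q, IsClosed L → q ∉ L → ∃ P ∈ 𝒮, q ∈ P.1 ∧ Disjoint L P.2 := by
  have hbasis := TopologicalSpace.isBasis_countableBasis X
  have hcount := TopologicalSpace.countable_countableBasis X
  set 𝓑 := TopologicalSpace.countableBasis X
  refine ⟨(fun B => (closure B.1, B.2)) '' {B ∈ 𝓑 ×ˢ 𝓑 | closure B.1 ⊆ B.2},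
    ((hcount.prod hcount).mono (sep_subset _ _)).image _, ?_, fun L q hL hq => ?_⟩
  · rintro _ ⟨B, ⟨hB, hBcl⟩, rfl⟩
    exact ⟨isClosed_closure, hbasis.isOpen hB.2, hBcl⟩
  · obtain ⟨B₂, hB₂, hqB₂, hB₂L⟩ := hbasis.exists_subset_of_mem_open hq hL.isOpen_compl
    obtain ⟨B₁, hB₁, hqB₁, hB₁B₂⟩ := hbasis.exists_closure_subset
      ((hbasis.isOpen hB₂).mem_nhds hqB₂)
    exact ⟨_, ⟨(B₁, B₂), ⟨⟨hB₁, hB₂⟩, hB₁B₂⟩, rfl⟩, subset_closure hqB₁,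
      (subset_compl_iff_disjoint_left.mp hB₂L)⟩

theorem dense_hasFiberComponentsInCrossings [CompactSpace X] [T2Space X]
    [SecondCountableTopology X] : Dense {h : C(X, ℝ) | HasFiberComponentsInCrossings h} := by
  obtain ⟨𝒮, h𝒮, hpair, hsep⟩ := exists_countable_separating_pairs (X := X)
  have hgeneric : ∀ᶠ h : C(X, ℝ) in residual C(X, ℝ), ∀ P ∈ 𝒮, ∀ a b : ℚ, a < b →
      ∀ L, Disjoint L P.2 → IsCrossing h L a b → HasCrossingAvoiding h P.1 L a b := by
    simp only [eventually_countable_ball h𝒮, eventually_countable_forall]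
    intro P hP a b hab
    obtain ⟨hA, hU, hAU⟩ := hpair P hP
    exact eventually_residual_hasCrossingAvoiding hA hU hAU (Rat.cast_lt.mpr hab)
  refine dense_of_mem_residual (hgeneric.mono fun h hh L a b hL => ?_)
  obtain ⟨p, -, hpab, hp⟩ := hL.exists_forall_disjoint_fiberComponent h.continuous
    (𝒜 := Prod.fst '' {P ∈ 𝒮 | Disjoint L P.2}) ((h𝒮.mono (sep_subset _ _)).image _) (by
      rintro _ ⟨P, ⟨hP, hLP⟩, rfl⟩ M hML c d hM
      obtain ⟨a', hca, had⟩ := exists_rat_btwn hM.lt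
      obtain ⟨b', hab, hbd⟩ := exists_rat_btwn had
      obtain ⟨L', hL', c', d', hcd, hcross⟩ := hh P hP a' b' (Rat.cast_lt.mp hab) M
        (hLP.mono_left hML) (hM.mono hca.le hab hbd.le)
      exact ⟨L', hL', c', d', hcd.trans (Icc_subset_Icc hca.le hbd.le), hcross⟩)
  refine ⟨p, hpab, fun q hq => by_contra fun hqL => ?_⟩
  obtain ⟨P, hP, hqP, hLP⟩ := hsep L q hL.isCompact.isClosed hqL
  exact disjoint_left.mp (hp P.1 ⟨P, ⟨hP, hLP⟩, rfl⟩) hq hqP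

theorem isKrasinkiewiczMap_iff {M : Type*} [TopologicalSpace M] {g : C(X, M)} :
    IsKrasinkiewiczMap g ↔ ∀ L, IsCompact L → IsConnected L →
      ∀ x ∈ L, ∀ y ∈ L, g x ≠ g y → ∃ p, fiberComponent g p ⊆ L := by
  refine ⟨fun hg L hLc hL x hx y hy hxy => ?_, fun hg L hLc hL => ?_⟩
  · obtain ⟨z, hz⟩ | ⟨_, p, rfl, hp⟩ := hg L hLc hL
    · exact absurd ((hz hx).trans (hz hy).symm) hxy
    · exact ⟨p, hp⟩
  · obtain ⟨x, hx⟩ := hL.nonempty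
    by_cases hconst : ∀ y ∈ L, g y = g x
    · exact Or.inl ⟨g x, hconst⟩
    · push Not at hconst
      obtain ⟨y, hy, hyx⟩ := hconst
      obtain ⟨p, hp⟩ := hg L hLc hL y hy x hx hyx
      exact Or.inr ⟨g p, p, rfl, hp⟩

theorem isKrasinkiewiczMap_of_eq_iff_forall_eq {ι M : Type*} {N : ι → Type*} [TopologicalSpace M]
    [∀ i, TopologicalSpace (N i)] {g : C(X, M)} {h : ∀ i, C(X, N i)}
    (hgh : ∀ x y, g x = g y ↔ ∀ i, h i x = h i y) (hh : ∀ i, IsKrasinkiewiczMap (h i)) :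
    IsKrasinkiewiczMap g := by
  refine isKrasinkiewiczMap_iff.mpr fun L hLc hL x hx y hy hxy => ?_
  obtain ⟨i, hi⟩ := not_forall.mp (mt (hgh x y).mpr hxy)
  obtain ⟨p, hp⟩ := isKrasinkiewiczMap_iff.mp (hh i) L hLc hL x hx y hy hi
  exact ⟨p, (fiberComponent_subset_fiberComponent fun q hq => (hgh q p).mp hq i).trans hp⟩

theorem HasFiberComponentsInCrossings.isKrasinkiewiczMap_projIcc_comp {k : C(X, ℝ)}
    (hk : HasFiberComponentsInCrossings k) {a b : ℝ} (hab : a ≤ b) :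
    IsKrasinkiewiczMap (⟨projIcc a b hab ∘ k, continuous_projIcc.comp k.continuous⟩ :
      C(X, Icc a b)) := by
  refine isKrasinkiewiczMap_iff.mpr fun L hLc hL x hx y hy hxy => ?_
  simp only [ContinuousMap.coe_mk, Function.comp_apply] at hxy ⊢
  wlog hlt : projIcc a b hab (k x) < projIcc a b hab (k y) generalizing x y
  · exact this y hy x hx hxy.symm (hxy.lt_or_gt.resolve_left hlt)
  have hkxy : max a (k x) < min b (k y) := by
    have := Subtype.coe_lt_coe.mpr hlt
    simp only [coe_projIcc] at this
    grind
  obtain ⟨c, hc, hcb⟩ := exists_between hkxy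
  obtain ⟨d, hcd, hd⟩ := exists_between hcb
  rw [max_lt_iff] at hc
  rw [lt_min_iff] at hd
  obtain ⟨p, hp, hpL⟩ := hk L c d
    (isCrossing_of_le_of_le k.continuous hLc hL hcd hx hc.2.le hy hd.2.le)
  refine ⟨p, (fiberComponent_subset_fiberComponent fun q hq => ?_).trans hpL⟩
  have hq' := congrArg Subtype.val hq
  simp only [Function.comp_apply, coe_projIcc] at hq'
  grind

/-- The values `0` and `1` are preserved because the function is first stretched away from `1 / 2`,
then perturbed, and then projected back to the unit interval. -/
theorem exists_isKrasinkiewiczMap_dist_le [CompactSpace X] [T2Space X]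
    [SecondCountableTopology X] (f : C(X, unitInterval)) {ε : ℝ} (hε : 0 < ε) :
    ∃ h : C(X, unitInterval), IsKrasinkiewiczMap h ∧ (∀ x, dist (h x) (f x) ≤ ε) ∧
      (∀ x, f x = 0 → h x = 0) ∧ ∀ x, f x = 1 → h x = 1 := by
  let stretched : C(X, ℝ) := ⟨fun x => f x + ε / 2 * (2 * f x - 1), by fun_prop⟩
  obtain ⟨k, hkf, hk⟩ := Metric.dense_iff.mp dense_hasFiberComponentsInCrossings stretched
    (ε / 2) (half_pos hε)
  have hclose (x : X) : |k x - (f x + ε / 2 * (2 * f x - 1))| ≤ ε / 2 :=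
    (ContinuousMap.dist_apply_le_dist x).trans (Metric.mem_ball.mp hkf).le
  refine ⟨_, HasFiberComponentsInCrossings.isKrasinkiewiczMap_projIcc_comp hk zero_le_one,
    fun x => ?_, fun x hx => ?_, fun x hx => ?_⟩
  · have hstretch : |ε / 2 * (2 * (f x : ℝ) - 1)| ≤ ε / 2 := by
      rw [abs_mul, abs_of_pos (half_pos hε)]
      refine mul_le_of_le_one_right (half_pos hε).le (abs_le.mpr ⟨?_, ?_⟩) <;>
        linarith [(f x).2.1, (f x).2.2]
    calc |(projIcc 0 1 zero_le_one (k x) : ℝ) - f x|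
        = |(projIcc 0 1 zero_le_one (k x) : ℝ) - projIcc 0 1 zero_le_one (f x : ℝ)| := by
          rw [projIcc_val]
      _ ≤ |k x - f x| := abs_projIcc_sub_projIcc _
      _ = |(k x - (f x + ε / 2 * (2 * f x - 1))) + ε / 2 * (2 * f x - 1)| := by ring_nf
      _ ≤ ε / 2 + ε / 2 := (abs_add_le _ _).trans (add_le_add (hclose x) hstretch)
      _ = ε := add_halves ε
  · refine projIcc_of_le_left zero_le_one ?_
    have := hclose x
    rw [hx, Icc.coe_zero, abs_le] at this
    linarith
  · refine projIcc_of_right_le zero_le_one ?_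
    have := hclose x
    rw [hx, Icc.coe_one, abs_le] at this
    linarith

end FiberComponents

section Polyhedron

variable {V : Type*} {K : PreAbstractSimplicialComplex V}

theorem sum_eq_one_of_mem_realization {x : lp (fun _ : V => ℝ) 2} (hx : x ∈ K.realization)
    {t : Finset V} (ht : ∀ v ∉ t, x v = 0) : ∑ v ∈ t, x v = 1 := by
  classical
  obtain ⟨-, s, -, hs, hs1⟩ := hx
  calc ∑ v ∈ t, x v = ∑ v ∈ t ∪ s, x v :=
        Finset.sum_subset Finset.subset_union_left fun v _ => ht v
    _ = ∑ v ∈ s, x v := (Finset.sum_subset Finset.subset_union_right fun v _ => hs v).symm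
    _ = 1 := hs1

theorem sum_le_one_of_mem_realization {x : lp (fun _ : V => ℝ) 2} (hx : x ∈ K.realization)
    (t : Finset V) : ∑ v ∈ t, x v ≤ 1 := by
  classical
  have ⟨h0, s, _, hs, _⟩ := hx
  calc ∑ v ∈ t, x v ≤ ∑ v ∈ t ∪ s, x v :=
        Finset.sum_le_sum_of_subset_of_nonneg Finset.subset_union_left fun v _ _ => h0 v
    _ = 1 := sum_eq_one_of_mem_realization hx fun v hv =>
        hs v fun hvs => hv (Finset.mem_union_right t hvs)

theorem dist_le_of_forall_abs_coord_sub_le {x y : K.Polyhedron} {ε : ℝ} (hε : 0 ≤ ε)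
    (h : ∀ v, |x.1 v - y.1 v| ≤ ε ^ 2 / 2) : dist x y ≤ ε := by
  rw [Subtype.dist_eq, dist_eq_norm]
  refine lp.norm_le_of_forall_sum_le (by norm_num) hε fun t => ?_
  simp only [ENNReal.toReal_ofNat, Real.rpow_ofNat]
  have habs (v : V) : |x.1 v - y.1 v| ≤ x.1 v + y.1 v :=
    abs_le.mpr ⟨by linarith [x.2.1 v], by linarith [y.2.1 v]⟩
  calc ∑ v ∈ t, ‖(x.1 - y.1) v‖ ^ 2 ≤ ∑ v ∈ t, ε ^ 2 / 2 * (x.1 v + y.1 v) := by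
        refine Finset.sum_le_sum fun v _ => ?_
        rw [lp.coeFn_sub, Pi.sub_apply, Real.norm_eq_abs, sq]
        exact mul_le_mul (h v) (habs v) (abs_nonneg _) (by positivity)
    _ = ε ^ 2 / 2 * (∑ v ∈ t, x.1 v + ∑ v ∈ t, y.1 v) := by
        rw [← Finset.mul_sum, Finset.sum_add_distrib]
    _ ≤ ε ^ 2 / 2 * (1 + 1) := by
        gcongr
        exacts [sum_le_one_of_mem_realization x.2 t, sum_le_one_of_mem_realization y.2 t]
    _ = ε ^ 2 := by ring

variable {X : Type*} [TopologicalSpace X]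

theorem dist_lt_of_forall_abs_coord_sub_le [CompactSpace X] {f g : C(X, K.Polyhedron)} {ε : ℝ}
    (hε : 0 < ε) (h : ∀ x v, |(f x).1 v - (g x).1 v| ≤ (ε / 2) ^ 2 / 2) : dist f g < ε :=
  ((ContinuousMap.dist_le (half_pos hε).le).mpr fun x =>
    dist_le_of_forall_abs_coord_sub_le (half_pos hε).le (h x)).trans_lt (half_lt_self hε)

theorem continuous_polyhedron_coord (f : C(X, K.Polyhedron)) (v : V) :
    Continuous fun x => (f x).1 v :=
  (lp.evalCLM ℝ (fun _ : V => ℝ) 2 v).continuous.comp (continuous_subtype_val.comp f.continuous)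

theorem exists_finset_lt_sum_coord [CompactSpace X] (f : C(X, K.Polyhedron)) {r : ℝ}
    (hr : r < 1) : ∃ S : Finset V, ∀ x, r < ∑ v ∈ S, (f x).1 v := by
  classical
  choose s _ _ hs using fun x => (f x).2.2
  obtain ⟨t, ht⟩ := isCompact_univ.elim_finite_subcover
    (fun x => {y | r < ∑ v ∈ s x, (f y).1 v})
    (fun x => isOpen_lt continuous_const
      (continuous_finsetSum _ fun v _ => continuous_polyhedron_coord f v))
    (fun x _ => mem_iUnion.mpr ⟨x, hr.trans_eq (hs x).symm⟩)
  refine ⟨t.biUnion s, fun y => ?_⟩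
  obtain ⟨x, hx, hy⟩ := mem_iUnion₂.mp (ht (mem_univ y))
  exact lt_of_lt_of_le hy (Finset.sum_le_sum_of_subset_of_nonneg
    (Finset.subset_biUnion_of_mem s hx) fun v _ _ => (f y).2.1 v)

theorem exists_continuousMap_coord_eq_div_sum {S : Finset V} {y : V → X → ℝ}
    (hy : ∀ v, Continuous (y v)) (hy0 : ∀ x v, 0 ≤ y v x) (hpos : ∀ x, 0 < ∑ v ∈ S, y v x)
    (hS : ∀ x, ∀ v ∉ S, y v x = 0) (hK : ∀ x, ∃ s ∈ K.faces, ∀ v ∉ s, y v x = 0) :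
    ∃ g : C(X, K.Polyhedron), ∀ x v, (g x).1 v = y v x / ∑ w ∈ S, y w x := by
  classical
  let g (x : X) : lp (fun _ : V => ℝ) 2 :=
    ∑ v ∈ S, (y v x / ∑ w ∈ S, y w x) • lp.single (E := fun _ : V => ℝ) 2 v 1
  have hg (x : X) (v : V) : g x v = y v x / ∑ w ∈ S, y w x := by
    simp only [g, lp.coeFn_sum, Finset.sum_apply, lp.coeFn_smul, Pi.smul_apply, smul_eq_mul,
      lp.single_apply, Pi.single_apply, mul_ite, mul_one, mul_zero, Finset.sum_ite_eq]
    split_ifs with hv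
    · rfl
    · rw [hS x v hv, zero_div]
  have hgK (x : X) : g x ∈ K.realization := by
    obtain ⟨s, hs, hs0⟩ := hK x
    refine ⟨fun v => ?_, s, hs, fun v hv => ?_, ?_⟩
    · rw [hg]
      exact div_nonneg (hy0 x v) (hpos x).le
    · rw [hg, hs0 v hv, zero_div]
    · have hsum : ∑ v ∈ s, y v x = ∑ v ∈ S, y v x :=
        (Finset.sum_subset Finset.subset_union_left fun v _ => hs0 v).trans
          (Finset.sum_subset Finset.subset_union_right fun v _ => hS x v).symm
      simp only [hg, ← Finset.sum_div, hsum, div_self (hpos x).ne']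
  have hgc : Continuous g := continuous_finsetSum _ fun v _ => ((hy v).div
    (continuous_finsetSum _ fun w _ => hy w) fun x => (hpos x).ne').smul continuous_const
  exact ⟨⟨fun x => ⟨g x, hgK x⟩, hgc.subtype_mk hgK⟩, hg⟩

theorem abs_div_sub_self_le {a r : ℝ} (ha : 0 ≤ a) (har : a ≤ r) (hr0 : 0 < r) (hr1 : r ≤ 1) :
    |a / r - a| ≤ 1 - r :=
  calc |a / r - a| = a / r * (1 - r) := by
        rw [abs_of_nonneg (sub_nonneg.mpr (le_div_self ha hr0 hr1)), mul_one_sub,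
          div_mul_cancel₀ _ hr0.ne']
    _ ≤ 1 - r := mul_le_of_le_one_left (sub_nonneg.mpr hr1) ((div_le_one hr0).mpr har)

theorem dense_setOf_forall_notMem_coord_eq_zero [CompactSpace X] :
    Dense {f : C(X, K.Polyhedron) | ∃ S : Finset V, ∀ x, ∀ v ∉ S, (f x).1 v = 0} := by
  classical
  refine Metric.dense_iff.mpr fun f ε hε => ?_
  obtain ⟨S, hS⟩ := exists_finset_lt_sum_coord f (r := max 0 (1 - (ε / 2) ^ 2 / 2))
    (max_lt zero_lt_one (sub_lt_self 1 (by positivity)))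
  simp only [max_lt_iff] at hS
  have hsum (x : X) : ∑ v ∈ S, (if v ∈ S then (f x).1 v else 0) = ∑ v ∈ S, (f x).1 v :=
    Finset.sum_congr rfl fun v hv => if_pos hv
  obtain ⟨g, hg⟩ := exists_continuousMap_coord_eq_div_sum (K := K) (S := S)
    (y := fun v x => if v ∈ S then (f x).1 v else 0)
    (fun v => by split_ifs; exacts [continuous_polyhedron_coord f v, continuous_const])
    (fun x v => by split_ifs; exacts [(f x).2.1 v, le_rfl])
    (fun x => (hS x).1.trans_eq (hsum x).symm) (fun x v hv => if_neg hv)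
    fun x => (f x).2.2.imp fun s hs => ⟨hs.1, fun v hv => by rw [hs.2.1 v hv, ite_self]⟩
  simp only [hsum] at hg
  refine ⟨g, dist_lt_of_forall_abs_coord_sub_le hε fun x v => ?_, S,
    fun x v hv => by rw [hg, if_neg hv, zero_div]⟩
  refine le_trans ?_ (sub_le_comm.mp (hS x).2.le)
  have h0 := (f x).2.1
  rw [hg]
  split_ifs with hv
  · exact abs_div_sub_self_le (h0 v) (Finset.single_le_sum (fun w _ => h0 w) hv) (hS x).1
      (sum_le_one_of_mem_realization (f x).2 S)
  · have hle := sum_le_one_of_mem_realization (f x).2 (insert v S)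
    rw [Finset.sum_insert hv] at hle
    rw [zero_div, zero_sub, abs_neg, abs_of_nonneg (h0 v)]
    linarith

theorem one_le_sum_of_exists_eq_one {ι : Type*} {S : Finset ι} {y : ι → ℝ} (hy : ∀ i, 0 ≤ y i)
    (hy1 : ∃ i ∈ S, y i = 1) : 1 ≤ ∑ i ∈ S, y i :=
  have ⟨_, hi, hi1⟩ := hy1
  hi1.ge.trans (Finset.single_le_sum (fun j _ => hy j) hi)

theorem eq_of_forall_div_eq_div {ι : Type*} {y z : ι → ℝ} {Y Z : ℝ} (hY : 0 < Y) (hZ : 0 < Z)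
    (hy : ∀ i, y i ≤ 1) (hz : ∀ i, z i ≤ 1) (hy1 : ∃ i, y i = 1) (hz1 : ∃ i, z i = 1)
    (h : ∀ i, y i / Y = z i / Z) : y = z := by
  obtain ⟨i, hi⟩ := hy1
  obtain ⟨j, hj⟩ := hz1
  have hZY : Z ≤ Y := by
    rw [← one_div_le_one_div hY hZ, ← hi, h i]
    gcongr
    exact hi ▸ hz i
  have hYZ : Y ≤ Z := by
    rw [← one_div_le_one_div hZ hY, ← hj, ← h j]
    gcongr
    exact hj ▸ hy j
  obtain rfl := le_antisymm hYZ hZY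
  exact funext fun v => (div_left_inj' hY.ne').mp (h v)

theorem abs_div_sum_sub_div_sum_le {ι : Type*} {S : Finset ι} {y z : ι → ℝ} {η : ℝ}
    (hy : 1 ≤ ∑ i ∈ S, y i) (hz : 0 < ∑ i ∈ S, z i) (hz0 : ∀ i ∈ S, 0 ≤ z i)
    (hyz : ∀ i ∈ S, |y i - z i| ≤ η) {i : ι} (hi : i ∈ S) :
    |y i / ∑ j ∈ S, y j - z i / ∑ j ∈ S, z j| ≤ (S.card + 1) * η := by
  have hsum : |∑ j ∈ S, z j - ∑ j ∈ S, y j| ≤ S.card * η := by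
    rw [← Finset.sum_sub_distrib, ← nsmul_eq_mul]
    refine (Finset.abs_sum_le_sum_abs _ _).trans (Finset.sum_le_card_nsmul _ _ _ fun j hj => ?_)
    exact (abs_sub_comm _ _).trans_le (hyz j hj)
  have hzi : z i / ∑ j ∈ S, z j ≤ 1 := (div_le_one hz).mpr (Finset.single_le_sum hz0 hi)
  set Y := ∑ j ∈ S, y j
  set Z := ∑ j ∈ S, z j
  have hY : 0 < Y := zero_lt_one.trans_le hy
  calc |y i / Y - z i / Z| = |(y i - z i) + z i / Z * (Z - Y)| / Y := by
        rw [← abs_of_pos hY, ← abs_div, abs_of_pos hY]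
        congr 1
        field_simp
        ring
    _ ≤ |(y i - z i) + z i / Z * (Z - Y)| := div_le_self (abs_nonneg _) hy
    _ ≤ |y i - z i| + z i / Z * |Z - Y| := by
        refine (abs_add_le _ _).trans_eq ?_
        rw [abs_mul, abs_of_nonneg (div_nonneg (hz0 i hi) hz.le)]
    _ ≤ η + S.card * η :=
        add_le_add (hyz i hi) ((mul_le_of_le_one_left (abs_nonneg _) hzi).trans hsum)
    _ = (S.card + 1) * η := by ring

theorem exists_max_normalized_coord {f : C(X, K.Polyhedron)} {S : Finset V}
    (hf : ∀ x, ∀ v ∉ S, (f x).1 v = 0) :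
    ∃ q : V → C(X, unitInterval), (∀ x, ∃ v ∈ S, q v x = 1) ∧
      ∀ x v, (f x).1 v = q v x / ∑ w ∈ S, (q w x : ℝ) := by
  let m (x : X) : ℝ := ‖fun v : S => (f x).1 v‖
  have hm : Continuous m :=
    (continuous_pi fun v : S => continuous_polyhedron_coord f v).norm
  have hsum (x : X) : ∑ v ∈ S, (f x).1 v = 1 := sum_eq_one_of_mem_realization (f x).2 (hf x)
  have hfm (x : X) (v : V) : (f x).1 v ≤ m x := by
    by_cases hv : v ∈ S
    · exact (le_abs_self _).trans (norm_le_pi_norm (fun v : S => (f x).1 v) ⟨v, hv⟩)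
    · exact (hf x v hv).trans_le (norm_nonneg _)
  have hpos (x : X) : 0 < m x := by
    by_contra! hx
    linarith [hsum x, Finset.sum_nonpos fun v (_ : v ∈ S) => (hfm x v).trans hx]
  have hmax (x : X) : ∃ v ∈ S, (f x).1 v = m x := by
    by_contra! hne
    refine lt_irrefl (m x) ((pi_norm_lt_iff (hpos x)).mpr fun v => ?_)
    rw [Real.norm_of_nonneg ((f x).2.1 v)]
    exact (hfm x v).lt_of_ne (hne v v.2)
  refine ⟨fun v => ⟨fun x => ⟨(f x).1 v / m x, div_nonneg ((f x).2.1 v) (hpos x).le,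
    (div_le_one (hpos x)).mpr (hfm x v)⟩, ((continuous_polyhedron_coord f v).div hm
      fun x => (hpos x).ne').subtype_mk _⟩, fun x => ?_, fun x v => ?_⟩
  · obtain ⟨v, hv, hvm⟩ := hmax x
    exact ⟨v, hv, Subtype.ext ((div_eq_one_iff_eq (hpos x).ne').mpr hvm)⟩
  · simp only [ContinuousMap.coe_mk, ← Finset.sum_div, hsum]
    rw [div_div_div_cancel_right₀ (hpos x).ne', div_one]

theorem isKrasinkiewiczMap_of_coord_eq_div_sum {g : C(X, K.Polyhedron)} {S : Finset V}
    {h : V → C(X, unitInterval)} (hh : ∀ v, IsKrasinkiewiczMap (h v))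
    (h1 : ∀ x, ∃ v ∈ S, h v x = 1) (hg : ∀ x v, (g x).1 v = h v x / ∑ w ∈ S, (h w x : ℝ)) :
    IsKrasinkiewiczMap g := by
  have hsum (x : X) : 0 < ∑ v ∈ S, (h v x : ℝ) :=
    zero_lt_one.trans_le (one_le_sum_of_exists_eq_one (fun v => (h v x).2.1)
      ((h1 x).imp fun v hv => ⟨hv.1, congrArg Subtype.val hv.2⟩))
  have hexists (x : X) : ∃ v, (h v x : ℝ) = 1 := (h1 x).imp fun v hv => congrArg Subtype.val hv.2
  refine isKrasinkiewiczMap_of_eq_iff_forall_eq (fun x y => ⟨fun hxy v => ?_, fun hxy => ?_⟩) hh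
  · have hratio (v : V) : (h v x : ℝ) / ∑ w ∈ S, (h w x : ℝ) = h v y / ∑ w ∈ S, (h w y : ℝ) := by
      rw [← hg, ← hg, hxy]
    exact Subtype.ext (congrFun (eq_of_forall_div_eq_div (hsum x) (hsum y)
      (fun v => (h v x).2.2) (fun v => (h v y).2.2) (hexists x) (hexists y) hratio) v)
  · exact Subtype.ext (lp.ext (funext fun v => by simp only [hg, hxy]))

theorem mem_closure_isKrasinkiewiczMap [CompactSpace X] [T2Space X] [SecondCountableTopology X]
    {f : C(X, K.Polyhedron)} {S : Finset V} (hf : ∀ x, ∀ v ∉ S, (f x).1 v = 0) :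
    f ∈ closure {g : C(X, K.Polyhedron) | IsKrasinkiewiczMap g} := by
  refine Metric.mem_closure_iff.mpr fun ε hε => ?_
  obtain ⟨q, hq1, hfq⟩ := exists_max_normalized_coord hf
  set η : ℝ := (ε / 2) ^ 2 / 2 / (S.card + 1) with hη
  choose h hh hhq h0 h1 using fun v =>
    exists_isKrasinkiewiczMap_dist_le (q v) (show 0 < η by positivity)
  have hh1 (x : X) : ∃ v ∈ S, h v x = 1 := (hq1 x).imp fun v hv => ⟨hv.1, h1 v x hv.2⟩
  have hsum {p : V → C(X, unitInterval)} (hp : ∀ x, ∃ v ∈ S, p v x = 1) (x : X) :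
      1 ≤ ∑ v ∈ S, (p v x : ℝ) := one_le_sum_of_exists_eq_one (fun v => (p v x).2.1)
    ((hp x).imp fun v hv => ⟨hv.1, congrArg Subtype.val hv.2⟩)
  have hzero {x : X} {v : V} (hv : (f x).1 v = 0) : (h v x : ℝ) = 0 := by
    rw [hfq, div_eq_zero_iff, or_iff_left (zero_lt_one.trans_le (hsum hq1 x)).ne'] at hv
    exact congrArg Subtype.val (h0 v x (Subtype.ext hv))
  obtain ⟨g, hg⟩ := exists_continuousMap_coord_eq_div_sum (K := K) (S := S)
    (y := fun v x => (h v x : ℝ)) (fun v => by fun_prop) (fun x v => (h v x).2.1)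
    (fun x => zero_lt_one.trans_le (hsum hh1 x)) (fun x v hv => hzero (hf x v hv))
    fun x => (f x).2.2.imp fun s hs => ⟨hs.1, fun v hv => hzero (hs.2.1 v hv)⟩
  refine ⟨g, isKrasinkiewiczMap_of_coord_eq_div_sum hh hh1 hg,
    dist_lt_of_forall_abs_coord_sub_le hε fun x v => ?_⟩
  by_cases hv : v ∈ S
  · rw [hfq, hg]
    refine (abs_div_sum_sub_div_sum_le (hsum hq1 x) (zero_lt_one.trans_le (hsum hh1 x))
      (fun w _ => (h w x).2.1) (fun w _ => ?_) hv).trans_eq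
      (mul_div_cancel₀ _ (by positivity))
    exact (abs_sub_comm _ _).trans_le (hhq w x)
  · rw [hf x v hv, hg, hzero (hf x v hv), zero_div, sub_zero, abs_zero]
    positivity

end Polyhedron

theorem corollary3p2 (V : Type u) (K : PreAbstractSimplicialComplex V) :
    IsKrasinkiewiczSpace.{w, u} K.Polyhedron := by
  intro X _ _ _
  let _ := TopologicalSpace.metrizableSpaceMetric X
  refine (dense_setOf_forall_notMem_coord_eq_zero.mono ?_).of_closure
  rintro f ⟨S, hS⟩
  exact mem_closure_isKrasinkiewiczMap hS
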